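/- Let $n \ge 3$ and let $\mathrm{St}_n(\mathbb{Z})$ be the Steinberg group of the integers, i.e. the group generated by symbols $x_{ij}(r)$ for $1 \le i, j \le n$, $i \neq j$, $r \in \mathbb{Z}$, subject to the relations 1. $x_{ij}(r)\,x_{ij}(s) = x_{ij}(r+s)$ for $i \ne j$; 2. $[x_{ij}(r), x_{jk}(s)] = x_{ik}(rs)$ for $i, j, k$ pairwise distinct; 3. $[x_{ij}(r), x_{pq}(s)] = 1$ for $i \ne j$, $p \ne q$ with $j \neq p$ and $i \neq q$, where $[x,y] = xyx^{-1}y^{-1}$. Then for every integer $k$ with $0 \le k \le n-1$, every group homomorphism $f : \mathrm{St}_n(\mathbb{Z}) \to \mathrm{GL}_k(\mathbb{Z})$ is trivial. -/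

import Mathlib

open scoped commutatorElement

/-- Symbols `x_{ij}(r)` with `1 ≤ i ≠ j ≤ n` and `r ∈ R`. -/
structure SteinbergGen (n : ℕ) (R : Type*) where
  i : Fin n
  j : Fin n
  ne : i ≠ j
  r : R

/-- The symbol `x_{ij}(r)` as an element of the free group on all such symbols. -/
def steinbergX {n : ℕ} {R : Type*} (i j : Fin n) (h : i ≠ j) (r : R) :
    FreeGroup (SteinbergGen n R) :=
  FreeGroup.of ⟨i, j, h, r⟩

/-- The Steinberg relators; the commutator is `⁅x, y⁆ = x * y * x⁻¹ * y⁻¹`. -/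
inductive SteinbergRel (n : ℕ) (R : Type*) [Ring R] : FreeGroup (SteinbergGen n R) → Prop
  | add (i j : Fin n) (h : i ≠ j) (r s : R) :
      SteinbergRel n R
        (steinbergX i j h r * steinbergX i j h s * (steinbergX i j h (r + s))⁻¹)
  | comm_mul (i j k : Fin n) (hij : i ≠ j) (hjk : j ≠ k) (hik : i ≠ k) (r s : R) :
      SteinbergRel n R
        (⁅steinbergX i j hij r, steinbergX j k hjk s⁆ * (steinbergX i k hik (r * s))⁻¹)
  | comm_one (i j p q : Fin n) (hij : i ≠ j) (hpq : p ≠ q) (hjp : j ≠ p) (hiq : i ≠ q)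
      (r s : R) :
      SteinbergRel n R ⁅steinbergX i j hij r, steinbergX p q hpq s⁆

/-- The Steinberg group `St_n(R)`. -/
abbrev SteinbergGroup (n : ℕ) (R : Type*) [Ring R] : Type _ :=
  PresentedGroup {w : FreeGroup (SteinbergGen n R) | SteinbergRel n R w}

/-! Extend scalars to `ℂ` and induct on `m = n - 1`, where dim `V ≤ m`. The commuting operators `A 0
j` have a joint eigenvector, and the `A i p` with `i, p ≠ 0` move its character by `a i ↦ a i * a
p`. A nontrivial character would yield `m + 1` distinct ones, too many for `V`, so the fixed space
`W` of the row is nonzero (`rowFixed_ne_bot`). If `W = V`, the row is trivial and hence the whole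
family. Otherwise the block of indices `≠ 0`, of rank `m`, acts on `W` and `V ⧸ W`, both of
dimension `< m`, hence trivially by induction. Its elements then commute on `V`, so some commutator
`A i k` is `1`, and this kills the family. For `m = 2` the block has rank two and no induction
applies; a computation in a plane replaces it. -/

/-- Units `A i j`, `i ≠ j`, of a monoid that satisfy the relations of the elements `x_{ij}(1)` of a
Steinberg group; the values `A i i` are irrelevant. -/
structure IsSteinbergFamily {M : Type*} [Monoid M] {n : ℕ} (A : Fin n → Fin n → M) : Prop where
  isUnit : ∀ i j, i ≠ j → IsUnit (A i j)
  comm_mul : ∀ i j k, i ≠ j → j ≠ k → i ≠ k → A i j * A j k = A i k * A j k * A i j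
  commute : ∀ i j p q, i ≠ j → p ≠ q → j ≠ p → i ≠ q → Commute (A i j) (A p q)

namespace IsSteinbergFamily

section Monoid

variable {M : Type*} [Monoid M] {n : ℕ} {A : Fin n → Fin n → M}

theorem succ {n : ℕ} {A : Fin (n + 1) → Fin (n + 1) → M} (hA : IsSteinbergFamily A) :
    IsSteinbergFamily fun i j : Fin n => A i.succ j.succ where
  isUnit i j h := hA.isUnit _ _ (by simpa using h)
  comm_mul i j k h₁ h₂ h₃ :=
    hA.comm_mul _ _ _ (by simpa using h₁) (by simpa using h₂) (by simpa using h₃)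
  commute i j p q h₁ h₂ h₃ h₄ :=
    hA.commute _ _ _ _ (by simpa using h₁) (by simpa using h₂) (by simpa using h₃)
      (by simpa using h₄)

theorem eq_one_of_commute (hA : IsSteinbergFamily A) {i j k : Fin n} (hij : i ≠ j) (hjk : j ≠ k)
    (hik : i ≠ k) (h : Commute (A i j) (A j k)) : A i k = 1 := by
  have h₁ := hA.comm_mul i j k hij hjk hik
  rw [h.eq, mul_assoc] at h₁
  exact (((hA.isUnit j k hjk).mul (hA.isUnit i j hij)).mul_eq_right).1 h₁.symm

theorem eq_one_of_left (hA : IsSteinbergFamily A) {i j k : Fin n} (hij : i ≠ j) (hjk : j ≠ k)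
    (hik : i ≠ k) (h : A i j = 1) : A i k = 1 :=
  hA.eq_one_of_commute hij hjk hik (h ▸ Commute.one_left _)

theorem eq_one_of_right (hA : IsSteinbergFamily A) {i j k : Fin n} (hij : i ≠ j) (hjk : j ≠ k)
    (hik : i ≠ k) (h : A j k = 1) : A i k = 1 :=
  hA.eq_one_of_commute hij hjk hik (h ▸ Commute.one_right _)

/-- Commutators spread triviality from `(a, b)` along row `a`, then to all entries off row and
column `a`, and through a third index to column `a`. -/
theorem eq_one_of_eq_one (hA : IsSteinbergFamily A) (hn : 3 ≤ n) {a b : Fin n} (hab : a ≠ b)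
    (h : A a b = 1) : ∀ i j, i ≠ j → A i j = 1 := by
  have third (i j : Fin n) : ∃ l, l ≠ i ∧ l ≠ j := by
    obtain ⟨l, hl⟩ := Finset.exists_mem_notMem_of_card_lt_card
      (s := {i, j}) (t := (Finset.univ : Finset (Fin n)))
      (Finset.card_le_two.trans_lt (by rw [Finset.card_fin]; omega))
    exact ⟨l, by simpa using hl.2⟩
  have row : ∀ j, a ≠ j → A a j = 1 := fun j hj => by
    rcases eq_or_ne b j with rfl | hbj
    · exact h
    · exact hA.eq_one_of_left hab hbj hj h
  have offRow : ∀ i j, i ≠ a → j ≠ a → i ≠ j → A i j = 1 := fun i j hi hj hij =>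
    hA.eq_one_of_right hi hj.symm hij (row j hj.symm)
  intro i j hij
  rcases eq_or_ne i a with rfl | hi
  · exact row j hij
  rcases eq_or_ne j a with rfl | hj
  · obtain ⟨l, hli, hlj⟩ := third i j
    exact hA.eq_one_of_left hli.symm hlj hij (offRow i l hi hlj hli.symm)
  · exact offRow i j hi hj hij

end Monoid

/-! ### Invariant subspaces and quotients -/

section Linear

variable {K V : Type*} [Field K] [AddCommGroup V] [Module K V]

theorem restrict [FiniteDimensional K V] {n : ℕ} {A : Fin n → Fin n → Module.End K V}
    (hA : IsSteinbergFamily A) (W : Submodule K V) (hW : ∀ i j, i ≠ j → ∀ v ∈ W, A i j v ∈ W) :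
    IsSteinbergFamily fun i j =>
      if h : i = j then (1 : Module.End K W) else (A i j).restrict (hW i j h) where
  isUnit i j h := by
    rw [dif_neg h, LinearMap.isUnit_iff_ker_eq_bot, LinearMap.ker_eq_bot']
    intro w hw
    have hu := (LinearMap.isUnit_iff_ker_eq_bot _).1 (hA.isUnit i j h)
    exact Subtype.ext (LinearMap.ker_eq_bot'.1 hu w (congrArg Subtype.val hw))
  comm_mul i j k h₁ h₂ h₃ := by
    rw [dif_neg h₁, dif_neg h₂, dif_neg h₃]
    ext w
    exact LinearMap.congr_fun (hA.comm_mul i j k h₁ h₂ h₃) w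
  commute i j p q h₁ h₂ h₃ h₄ := by
    rw [dif_neg h₁, dif_neg h₂]
    ext w
    exact LinearMap.congr_fun (hA.commute i j p q h₁ h₂ h₃ h₄).eq w

theorem quotient [FiniteDimensional K V] {n : ℕ} {A : Fin n → Fin n → Module.End K V}
    (hA : IsSteinbergFamily A) (W : Submodule K V) (hW : ∀ i j, i ≠ j → ∀ v ∈ W, A i j v ∈ W) :
    IsSteinbergFamily fun i j =>
      if h : i = j then (1 : Module.End K (V ⧸ W)) else W.mapQ W (A i j) (hW i j h) where
  isUnit i j h := by
    rw [dif_neg h, LinearMap.isUnit_iff_range_eq_top, LinearMap.range_eq_top]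
    have hu := LinearMap.range_eq_top.1 ((LinearMap.isUnit_iff_range_eq_top _).1 (hA.isUnit i j h))
    intro v
    obtain ⟨v, rfl⟩ := W.mkQ_surjective v
    obtain ⟨u, rfl⟩ := hu v
    exact ⟨W.mkQ u, rfl⟩
  comm_mul i j k h₁ h₂ h₃ := by
    rw [dif_neg h₁, dif_neg h₂, dif_neg h₃]
    ext v
    exact congrArg W.mkQ (LinearMap.congr_fun (hA.comm_mul i j k h₁ h₂ h₃) v)
  commute i j p q h₁ h₂ h₃ h₄ := by
    rw [dif_neg h₁, dif_neg h₂]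
    ext v
    exact congrArg W.mkQ (LinearMap.congr_fun (hA.commute i j p q h₁ h₂ h₃ h₄).eq v)

end Linear

end IsSteinbergFamily

/-! ### Joint eigenvectors of commuting operators -/

section CommutingFamily

variable {ι K V : Type*} [Field K] [AddCommGroup V] [Module K V]

/-- `a` is the character of a common eigenvector of the family `f`. -/
def HasJointEigenvalue (f : ι → Module.End K V) (a : ι → K) : Prop :=
  ∃ v ≠ 0, ∀ i, f i v = a i • v

theorem exists_hasJointEigenvalue [Finite ι] [IsAlgClosed K] [FiniteDimensional K V] [Nontrivial V]
    (f : ι → Module.End K V) (hf : ∀ i j, Commute (f i) (f j)) :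
    ∃ a, HasJointEigenvalue f a := by
  classical
  have := Fintype.ofFinite ι
  suffices h : ∀ s : Finset ι, ∃ a : ι → K, ∃ v ≠ 0, ∀ i ∈ s, f i v = a i • v by
    obtain ⟨a, v, hv, h⟩ := h Finset.univ
    exact ⟨a, v, hv, fun i => h i (Finset.mem_univ i)⟩
  intro s
  induction s using Finset.induction_on with
  | empty =>
    obtain ⟨v, hv⟩ := exists_ne (0 : V)
    exact ⟨0, v, hv, by simp⟩
  | insert j s hj ih =>
    obtain ⟨a, v, hv, h⟩ := ih
    let U : Submodule K V := ⨅ i ∈ s, (f i).eigenspace (a i)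
    have mem_U (u : V) : u ∈ U ↔ ∀ i ∈ s, f i u = a i • u := by
      simp [U, Submodule.mem_iInf]
    have hU : ∀ u ∈ U, f j u ∈ U := fun u hu => (mem_U _).2 fun i hi => by
      rw [← Module.End.mul_apply, (hf i j).eq, Module.End.mul_apply, (mem_U u).1 hu i hi, map_smul]
    have : Nontrivial U := ⟨⟨v, (mem_U v).2 h⟩, 0, fun h => hv (congrArg Subtype.val h)⟩
    obtain ⟨μ, hμ⟩ := Module.End.exists_eigenvalue ((f j).restrict hU)
    obtain ⟨u, hu⟩ := hμ.exists_hasEigenvector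
    refine ⟨Function.update a j μ, u, fun h => hu.2 (Subtype.ext h), fun i hi => ?_⟩
    rcases eq_or_ne i j with rfl | hij
    · simpa using congrArg Subtype.val hu.apply_eq_smul
    · rw [Function.update_of_ne hij]
      exact (mem_U u).1 u.2 i (Finset.mem_of_mem_insert_of_ne hi hij)

theorem card_le_finrank_of_hasJointEigenvalue {κ : Type*} [Fintype κ] [FiniteDimensional K V]
    {f : ι → Module.End K V} (hf : ∀ i j, Commute (f i) (f j)) {χ : κ → ι → K}
    (hχ : Function.Injective χ) (h : ∀ c, HasJointEigenvalue f (χ c)) :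
    Fintype.card κ ≤ Module.finrank K V := by
  choose v hv h using h
  have hind := (Module.End.independent_iInf_maxGenEigenspace_of_forall_mapsTo f
    fun i j φ => Module.End.mapsTo_maxGenEigenspace_of_comm (hf j i) φ).comp hχ
  refine (hind.linearIndependent _ (v := v) (fun c => ?_) hv).fintype_card_le_finrank
  refine (Submodule.mem_iInf _).2 fun i => ?_
  exact Module.End.mem_maxGenEigenspace _ _ _ |>.2 ⟨1, by simp [h c i]⟩

end CommutingFamily

/-! ### Characters and fixed vectors of the first row -/

namespace IsSteinbergFamily

variable {K V : Type*} [Field K] [AddCommGroup V] [Module K V]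

theorem commute_zero_row {M : Type*} [Monoid M] {m : ℕ} {A : Fin (m + 1) → Fin (m + 1) → M}
    (hA : IsSteinbergFamily A) (i j : Fin m) : Commute (A 0 i.succ) (A 0 j.succ) :=
  hA.commute _ _ _ _ (Fin.succ_ne_zero i).symm (Fin.succ_ne_zero j).symm (Fin.succ_ne_zero i)
    (Fin.succ_ne_zero j).symm

/-- The new eigenvector is `A i p v`: only `A 0 i` fails to commute with `A i p`, and the commutator
`A 0 p` contributes the factor `a p`. -/
theorem hasJointEigenvalue_update {m : ℕ} {A : Fin (m + 1) → Fin (m + 1) → Module.End K V}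
    [FiniteDimensional K V] (hA : IsSteinbergFamily A) {a : Fin m → K}
    (ha : HasJointEigenvalue (fun j : Fin m => A 0 j.succ) a) {i p : Fin m} (hip : i ≠ p) :
    HasJointEigenvalue (fun j : Fin m => A 0 j.succ) (Function.update a i (a i * a p)) := by
  obtain ⟨v, hv, h⟩ := ha
  have hip' : i.succ ≠ p.succ := by simpa using hip
  have hu := (LinearMap.isUnit_iff_ker_eq_bot _).1 (hA.isUnit i.succ p.succ hip')
  have key (j : Fin m) (hji : j ≠ i) : A 0 j.succ (A i.succ p.succ v) = a j • A i.succ p.succ v := by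
    have hc := hA.commute 0 j.succ i.succ p.succ (Fin.succ_ne_zero j).symm hip'
      (by simpa using hji) (Fin.succ_ne_zero p).symm
    rw [← Module.End.mul_apply, hc.eq, Module.End.mul_apply, h j, map_smul]
  refine ⟨A i.succ p.succ v, fun h0 => hv (LinearMap.ker_eq_bot'.1 hu v h0), fun j => ?_⟩
  rcases eq_or_ne j i with rfl | hji
  · have hc := LinearMap.congr_fun (hA.comm_mul 0 j.succ p.succ (Fin.succ_ne_zero j).symm hip'
      (Fin.succ_ne_zero p).symm) v
    simp only [Module.End.mul_apply, h j, map_smul, key p hip.symm] at hc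
    simp only [Function.update_self, hc, smul_smul]
  · simpa only [Function.update_of_ne hji] using key j hji

/-- In small dimension a joint eigenvector of a row of a Steinberg family is fixed by that row,
since otherwise the row would have too many characters. -/
theorem eq_one_of_hasJointEigenvalue {m : ℕ} {A : Fin (m + 1) → Fin (m + 1) → Module.End K V}
    [FiniteDimensional K V] (hA : IsSteinbergFamily A) (hm : 2 ≤ m) (hV : Module.finrank K V ≤ m)
    {a : Fin m → K} (ha : HasJointEigenvalue (fun j : Fin m => A 0 j.succ) a) (q : Fin m) :
    a q = 1 := by
  by_contra hq
  have ne_zero (b : Fin m → K) (hb : HasJointEigenvalue (fun j : Fin m => A 0 j.succ) b)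
      (j : Fin m) : b j ≠ 0 := by
    obtain ⟨v, hv, h⟩ := hb
    intro h0
    have hu := (LinearMap.isUnit_iff_ker_eq_bot _).1 (hA.isUnit 0 j.succ (Fin.succ_ne_zero j).symm)
    exact hv (LinearMap.ker_eq_bot'.1 hu v (by simpa [h0] using h j))
  have : Nontrivial (Fin m) := Fin.nontrivial_iff_two_le.2 hm
  obtain ⟨l, hl⟩ := exists_ne q
  -- Entry `q` cannot be multiplied by `a q` directly. If `a l = 1`, entry `l` first becomes `a q`,
  -- and then entry `q` becomes its square.
  have hc : ∃ c, HasJointEigenvalue (fun j : Fin m => A 0 j.succ) c ∧ c q ≠ a q := by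
    by_cases hal : a l = 1
    · refine ⟨_, hA.hasJointEigenvalue_update (hA.hasJointEigenvalue_update ha hl) hl.symm, ?_⟩
      simpa [Function.update_of_ne hl.symm, hal, ne_zero a ha q] using hq
    · refine ⟨_, hA.hasJointEigenvalue_update ha hl.symm, ?_⟩
      simpa [ne_zero a ha q] using hal
  obtain ⟨c, hc, hcq⟩ := hc
  -- The `m + 1` characters: `a`, then `c`, which differs from `a` at `q`, and for each `j ≠ q` one
  -- differing from `a` exactly at `j`.
  let χ : Option (Fin m) → Fin m → K := fun o => o.elim a fun j =>
    if j = q then c else Function.update a j (a j * a q)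
  have hχ : ∀ o, HasJointEigenvalue (fun j : Fin m => A 0 j.succ) (χ o) := by
    rintro (_ | j)
    · exact ha
    · by_cases hj : j = q
      · simpa [χ, hj] using hc
      · simpa [χ, hj] using hA.hasJointEigenvalue_update ha hj
  have moved (j : Fin m) : χ (some j) j ≠ a j := by
    by_cases hj : j = q
    · subst hj
      simpa [χ] using hcq
    · simpa [χ, hj, ne_zero a ha j] using hq
  have fixed (i j : Fin m) (hi : i ≠ q) (hij : j ≠ i) : χ (some i) j = a j := by
    simp [χ, hi, Function.update_of_ne hij]
  have inj : Function.Injective χ := by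
    rintro (_ | i) (_ | j) h
    · rfl
    · exact absurd (congrFun h j).symm (moved j)
    · exact absurd (congrFun h i) (moved i)
    · by_contra hij
      have hij : i ≠ j := fun h => hij (congrArg some h)
      by_cases hi : i = q
      · exact moved i ((congrFun h i).trans (fixed j i (fun hj => hij (hi.trans hj.symm)) hij))
      · exact moved j ((congrFun h j).symm.trans (fixed i j hi hij.symm))
  have := card_le_finrank_of_hasJointEigenvalue hA.commute_zero_row inj hχ
  rw [Fintype.card_option, Fintype.card_fin] at this
  omega

/-- The vectors fixed by the endomorphisms `A 0 j` with `j ≠ 0`. -/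
def rowFixed {m : ℕ} (A : Fin (m + 1) → Fin (m + 1) → Module.End K V) : Submodule K V :=
  ⨅ j : Fin m, (A 0 j.succ).eigenspace 1

theorem mem_rowFixed {m : ℕ} {A : Fin (m + 1) → Fin (m + 1) → Module.End K V} {v : V} :
    v ∈ rowFixed A ↔ ∀ j : Fin m, A 0 j.succ v = v := by
  simp [rowFixed, Submodule.mem_iInf]

theorem apply_mem_rowFixed {m : ℕ} {A : Fin (m + 1) → Fin (m + 1) → Module.End K V}
    (hA : IsSteinbergFamily A) (i p : Fin m) (hip : i ≠ p) (v : V) (hv : v ∈ rowFixed A) :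
    A i.succ p.succ v ∈ rowFixed A := by
  have hip' : i.succ ≠ p.succ := by simpa using hip
  rw [mem_rowFixed] at hv ⊢
  have key (j : Fin m) (hji : j ≠ i) : A 0 j.succ (A i.succ p.succ v) = A i.succ p.succ v := by
    have hc := hA.commute 0 j.succ i.succ p.succ (Fin.succ_ne_zero j).symm hip'
      (by simpa using hji) (Fin.succ_ne_zero p).symm
    rw [← Module.End.mul_apply, hc.eq, Module.End.mul_apply, hv j]
  intro j
  rcases eq_or_ne j i with rfl | hji
  · have hc := LinearMap.congr_fun (hA.comm_mul 0 j.succ p.succ (Fin.succ_ne_zero j).symm hip'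
      (Fin.succ_ne_zero p).symm) v
    simpa only [Module.End.mul_apply, hv j, key p hip.symm] using hc
  · exact key j hji

theorem rowFixed_ne_bot [IsAlgClosed K] [FiniteDimensional K V] [Nontrivial V] {m : ℕ}
    {A : Fin (m + 1) → Fin (m + 1) → Module.End K V} (hA : IsSteinbergFamily A) (hm : 2 ≤ m)
    (hV : Module.finrank K V ≤ m) : rowFixed A ≠ ⊥ := by
  obtain ⟨a, ha⟩ := exists_hasJointEigenvalue _ hA.commute_zero_row
  have ha1 := hA.eq_one_of_hasJointEigenvalue hm hV ha
  obtain ⟨v, hv, h⟩ := ha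
  exact (Submodule.ne_bot_iff _).2 ⟨v, mem_rowFixed.2 fun j => by simpa [ha1 j] using h j, hv⟩

end IsSteinbergFamily

/-! ### The plane case and the induction -/

theorem LinearMap.exists_eq_smul_of_finrank_le_one {K V : Type*} [Field K] [AddCommGroup V]
    [Module K V] [FiniteDimensional K V] (h : Module.finrank K V ≤ 1) (f : Module.End K V) :
    ∃ c : K, ∀ v, f v = c • v := by
  obtain ⟨e, he⟩ := finrank_le_one_iff.1 h
  obtain ⟨c, hc⟩ := he (f e)
  refine ⟨c, fun v => ?_⟩
  obtain ⟨d, rfl⟩ := he v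
  rw [map_smul, ← hc, smul_comm]

namespace IsSteinbergFamily

/-- A Steinberg family of rank three acts trivially on a plane in which its first row fixes
exactly a line. -/
theorem eq_one_of_finrank_rowFixed_le_one {K V : Type*} [Field K] [AddCommGroup V] [Module K V]
    [FiniteDimensional K V] {A : Fin 3 → Fin 3 → Module.End K V} (hA : IsSteinbergFamily A)
    (h₁ : Module.finrank K (rowFixed A) ≤ 1) (h₂ : Module.finrank K (V ⧸ rowFixed A) ≤ 1) :
    A 0 2 = 1 := by
  set W := rowFixed A
  have fixed (w : V) (hw : w ∈ W) : A 0 1 w = w ∧ A 0 2 w = w :=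
    ⟨mem_rowFixed.1 hw 0, mem_rowFixed.1 hw 1⟩
  rcases eq_or_ne W ⊤ with hW | hW
  · ext v
    exact (fixed v (hW ▸ Submodule.mem_top)).2
  have quot (f : Module.End K V) (hu : IsUnit f) (hf : ∀ w ∈ W, f w ∈ W) :
      ∃ c : K, c ≠ 0 ∧ ∀ v, W.mkQ (f v) = c • W.mkQ v := by
    obtain ⟨c, hc⟩ := LinearMap.exists_eq_smul_of_finrank_le_one h₂ (W.mapQ W f hf)
    refine ⟨c, ?_, fun v => hc (W.mkQ v)⟩
    rintro rfl
    refine hW (eq_top_iff.2 fun v _ => ?_)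
    obtain ⟨u, rfl⟩ := LinearMap.range_eq_top.1 ((LinearMap.isUnit_iff_range_eq_top _).1 hu) v
    rw [← W.ker_mkQ, LinearMap.mem_ker]
    simpa using hc (W.mkQ u)
  obtain ⟨x, -, hx⟩ := SetLike.exists_of_lt hW.lt_top
  have hx0 : W.mkQ x ≠ 0 := by rwa [Ne, ← LinearMap.mem_ker, W.ker_mkQ]
  -- Scalars on `V ⧸ W` commute, so a commutator acts there as `1`.
  have quot_eq_one {f g h : Module.End K V} {a b c : K} (ha : a ≠ 0) (hb : b ≠ 0)
      (hf : ∀ v, W.mkQ (f v) = a • W.mkQ v) (hg : ∀ v, W.mkQ (g v) = b • W.mkQ v)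
      (hh : ∀ v, W.mkQ (h v) = c • W.mkQ v) (hfg : f * g = h * g * f) : c = 1 := by
    have := congrArg W.mkQ (LinearMap.congr_fun hfg x)
    simp only [Module.End.mul_apply, hf, hg, hh, smul_smul] at this
    have := smul_left_injective K hx0 this
    have hab : (a * b) * c = (a * b) * 1 := by linear_combination -this
    exact mul_left_cancel₀ (mul_ne_zero ha hb) hab
  have hB₁ : ∀ w ∈ W, A 1 2 w ∈ W := hA.apply_mem_rowFixed 0 1 (by decide)
  have hB₂ : ∀ w ∈ W, A 2 1 w ∈ W := hA.apply_mem_rowFixed 1 0 (by decide)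
  obtain ⟨μ, hμ0, hμ⟩ := quot _ (hA.isUnit 1 2 (by decide)) hB₁
  obtain ⟨ν, hν0, hν⟩ := quot _ (hA.isUnit 2 1 (by decide)) hB₂
  obtain ⟨α, hα0, hα⟩ := quot _ (hA.isUnit 0 1 (by decide)) fun w hw => by rwa [(fixed w hw).1]
  obtain ⟨β, hβ0, hβ⟩ := quot _ (hA.isUnit 0 2 (by decide)) fun w hw => by rwa [(fixed w hw).2]
  obtain ⟨γ, hγ⟩ := LinearMap.exists_eq_smul_of_finrank_le_one h₁ ((A 1 2).restrict hB₁)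
  replace hγ (w : V) (hw : w ∈ W) : A 1 2 w = γ • w := congrArg Subtype.val (hγ ⟨w, hw⟩)
  have rel := hA.comm_mul 0 1 2 (by decide) (by decide) (by decide)
  have hβ1 : β = 1 := quot_eq_one hα0 hμ0 hα hμ hβ rel
  have hα1 : α = 1 := quot_eq_one hβ0 hν0 hβ hν hα
    (hA.comm_mul 0 2 1 (by decide) (by decide) (by decide))
  have split {f : Module.End K V} {c : K} (hf : ∀ v, W.mkQ (f v) = c • W.mkQ v) (v : V) :
      ∃ w ∈ W, f v = c • v + w := by
    refine ⟨f v - c • v, ?_, by abel⟩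
    rw [← W.ker_mkQ, LinearMap.mem_ker, map_sub, map_smul, hf, sub_self]
  ext v
  obtain ⟨p, hp, hpv⟩ := split hα v
  obtain ⟨m, hm, hmv⟩ := split hβ v
  obtain ⟨w, hw, hwv⟩ := split hμ v
  rw [hα1, one_smul] at hpv
  rw [hβ1, one_smul] at hmv
  have e₁ := LinearMap.congr_fun rel v
  have e₂ := LinearMap.congr_fun
    (hA.commute 0 2 1 2 (by decide) (by decide) (by decide) (by decide)).eq v
  simp only [Module.End.mul_apply, hpv, hmv, hwv, map_add, map_smul, (fixed w hw).1,
    (fixed w hw).2, (fixed p hp).2, hγ p hp, hγ m hm] at e₁ e₂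
  -- Either `μ ≠ γ` and the first identity gives `m = 0`, or `μ = γ` and the second gives `μ • m =
  -- 0`.
  have hm0 : m = 0 := by
    have e₃ : (μ - γ) • m = 0 := by linear_combination (norm := module) e₂
    have e₄ : (μ - γ) • p = μ • m := by linear_combination (norm := module) e₁
    rcases smul_eq_zero.1 e₃ with h | h
    · rw [h, zero_smul] at e₄
      exact (smul_eq_zero.1 e₄.symm).resolve_left hμ0
    · exact h
  rw [hmv, hm0, add_zero, Module.End.one_apply]

/-- A Steinberg family of rank `n ≥ 3` in dimension less than `n` is trivial. -/
theorem eq_one_of_finrank_lt {K : Type*} [Field K] [IsAlgClosed K] (m : ℕ) (hm : 2 ≤ m) :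
    ∀ (V : Type*) [AddCommGroup V] [Module K V] [FiniteDimensional K V]
      (A : Fin (m + 1) → Fin (m + 1) → Module.End K V), IsSteinbergFamily A →
      Module.finrank K V ≤ m → ∀ i j, i ≠ j → A i j = 1 := by
  induction m, hm using Nat.le_induction with
  | base =>
    intro V _ _ _ A hA hV
    refine hA.eq_one_of_eq_one le_rfl (a := 0) (b := 2) (by decide) ?_
    rcases subsingleton_or_nontrivial V with _ | _
    · exact Subsingleton.elim _ _
    have hpos := Submodule.one_le_finrank_iff.2 (hA.rowFixed_ne_bot le_rfl hV)
    have hsum := (rowFixed A).finrank_quotient_add_finrank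
    by_cases htop : rowFixed A = ⊤
    · ext v
      exact mem_rowFixed.1 (htop ▸ Submodule.mem_top) (1 : Fin 2)
    have hlt := Submodule.finrank_lt htop
    exact hA.eq_one_of_finrank_rowFixed_le_one (by omega) (by omega)
  | succ m hm ih =>
    intro V _ _ _ A hA hV
    rcases subsingleton_or_nontrivial V with _ | _
    · exact fun i j _ => Subsingleton.elim _ _
    have hpos := Submodule.one_le_finrank_iff.2 (hA.rowFixed_ne_bot (by omega) hV)
    have hsum := (rowFixed A).finrank_quotient_add_finrank
    by_cases htop : rowFixed A = ⊤
    · refine hA.eq_one_of_eq_one (by omega) (Fin.succ_ne_zero 0).symm ?_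
      ext v
      exact mem_rowFixed.1 (htop ▸ Submodule.mem_top) 0
    have hlt := Submodule.finrank_lt htop
    have hstab := hA.apply_mem_rowFixed
    have sub_trivial (i j : Fin (m + 1)) (hij : i ≠ j) (w : V) (hw : w ∈ rowFixed A) :
        A i.succ j.succ w = w := by
      have := ih _ _ (hA.succ.restrict (rowFixed A) hstab) (by omega) i j hij
      rw [dif_neg hij] at this
      exact congrArg Subtype.val (LinearMap.congr_fun this ⟨w, hw⟩)
    have quot_trivial (i j : Fin (m + 1)) (hij : i ≠ j) (v : V) :
        A i.succ j.succ v - v ∈ rowFixed A := by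
      have := ih _ _ (hA.succ.quotient (rowFixed A) hstab) (by omega) i j hij
      rw [dif_neg hij] at this
      exact (Submodule.Quotient.eq _).1 (LinearMap.congr_fun this ((rowFixed A).mkQ v))
    -- Both maps are the identity plus a map that kills `W` and has image in `W`; two such maps have
    -- product zero in either order.
    have comm {i j k l : Fin (m + 1)} (hij : i ≠ j) (hkl : k ≠ l) :
        Commute (A i.succ j.succ) (A k.succ l.succ) := by
      ext v
      have e₁ := sub_trivial i j hij _ (quot_trivial k l hkl v)
      have e₂ := sub_trivial k l hkl _ (quot_trivial i j hij v)
      rw [map_sub, sub_eq_iff_eq_add] at e₁ e₂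
      rw [Module.End.mul_apply, Module.End.mul_apply, e₁, e₂]
      abel
    have h01 : (0 : Fin (m + 1)) ≠ ⟨1, by omega⟩ := by simp [Fin.ext_iff]
    have h02 : (0 : Fin (m + 1)) ≠ ⟨2, by omega⟩ := by simp [Fin.ext_iff]
    have h12 : (⟨1, by omega⟩ : Fin (m + 1)) ≠ ⟨2, by omega⟩ := by simp [Fin.ext_iff]
    have hsucc {i j : Fin (m + 1)} (h : i ≠ j) : i.succ ≠ j.succ := by simpa using h
    exact hA.eq_one_of_eq_one (by omega) (hsucc h02)
      (hA.eq_one_of_commute (hsucc h01) (hsucc h12) (hsucc h02) (comm h01 h12))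

end IsSteinbergFamily

/-! ### From the Steinberg group to Steinberg families -/

namespace SteinbergGroup

variable {n : ℕ} {R : Type*} [Ring R]

/-- The element `x_{ij}(r)` of the Steinberg group. -/
def x (i j : Fin n) (h : i ≠ j) (r : R) : SteinbergGroup n R :=
  PresentedGroup.of ⟨i, j, h, r⟩

theorem x_add (i j : Fin n) (h : i ≠ j) (r s : R) : x i j h (r + s) = x i j h r * x i j h s := by
  have := PresentedGroup.one_of_mem
    (rels := {w : FreeGroup (SteinbergGen n R) | SteinbergRel n R w})
    (SteinbergRel.add i j h r s)
  rw [map_mul, map_inv, mul_inv_eq_one, map_mul] at this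
  exact this.symm

theorem commutator_x (i j k : Fin n) (hij : i ≠ j) (hjk : j ≠ k) (hik : i ≠ k) (r s : R) :
    ⁅x i j hij r, x j k hjk s⁆ = x i k hik (r * s) := by
  have := PresentedGroup.one_of_mem
    (rels := {w : FreeGroup (SteinbergGen n R) | SteinbergRel n R w})
    (SteinbergRel.comm_mul i j k hij hjk hik r s)
  rw [map_mul, map_inv, mul_inv_eq_one, map_commutatorElement] at this
  exact this

theorem commute_x (i j p q : Fin n) (hij : i ≠ j) (hpq : p ≠ q) (hjp : j ≠ p) (hiq : i ≠ q)
    (r s : R) : Commute (x i j hij r) (x p q hpq s) := by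
  have := PresentedGroup.one_of_mem
    (rels := {w : FreeGroup (SteinbergGen n R) | SteinbergRel n R w})
    (SteinbergRel.comm_one i j p q hij hpq hjp hiq r s)
  rw [map_commutatorElement] at this
  exact commutatorElement_eq_one_iff_commute.1 this

theorem isSteinbergFamily {M : Type*} [Monoid M] (f : SteinbergGroup n R →* M) :
    IsSteinbergFamily fun i j : Fin n => if h : i = j then 1 else f (x i j h 1) where
  isUnit i j h := by
    rw [dif_neg h]
    exact (Group.isUnit _).map f
  comm_mul i j k h₁ h₂ h₃ := by
    have := commutator_x i j k h₁ h₂ h₃ (1 : R) 1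
    rw [mul_one, commutatorElement_def, mul_inv_eq_iff_eq_mul, mul_inv_eq_iff_eq_mul] at this
    rw [dif_neg h₁, dif_neg h₂, dif_neg h₃, ← map_mul, this, map_mul, map_mul]
  commute i j p q h₁ h₂ h₃ h₄ := by
    rw [dif_neg h₁, dif_neg h₂]
    exact (commute_x i j p q h₁ h₂ h₃ h₄ 1 1).map f

/-- Over `ℤ`, additivity makes `x i j h r` a power of `x i j h 1`. -/
theorem hom_eq_one {G : Type*} [Group G] (f : SteinbergGroup n ℤ →* G)
    (hf : ∀ i j h, f (x i j h 1) = 1) : f = 1 := by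
  refine PresentedGroup.ext fun ⟨i, j, h, r⟩ => ?_
  let φ : Multiplicative ℤ →* G := f.comp <| MonoidHom.mk' (fun r => x i j h r.toAdd)
    fun r s => x_add i j h r.toAdd s.toAdd
  have : φ = 1 := MonoidHom.ext_mint (hf i j h)
  exact DFunLike.congr_fun this (Multiplicative.ofAdd r)

end SteinbergGroup

theorem mainTheorem5 (n k : ℕ) (hn : 3 ≤ n) (hk : k ≤ n - 1)
    (f : SteinbergGroup n ℤ →* Matrix.GeneralLinearGroup (Fin k) ℤ) :
    f = 1 := by
  obtain ⟨m, rfl⟩ : ∃ m, n = m + 1 := ⟨n - 1, by omega⟩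
  refine SteinbergGroup.hom_eq_one f fun i j h => ?_
  let toEnd : Matrix (Fin k) (Fin k) ℤ →* Module.End ℂ (Fin k → ℂ) :=
    (Matrix.toLinAlgEquiv' : _ ≃ₐ[ℂ] Module.End ℂ (Fin k → ℂ)).toMulEquiv.toMonoidHom.comp
      (Int.castRingHom ℂ).mapMatrix.toMonoidHom
  have hinj : Function.Injective toEnd :=
    (Matrix.toLinAlgEquiv' : _ ≃ₐ[ℂ] Module.End ℂ (Fin k → ℂ)).injective.comp
      (Matrix.map_injective Int.cast_injective)
  have := IsSteinbergFamily.eq_one_of_finrank_lt m (by omega) _ _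
    (SteinbergGroup.isSteinbergFamily (toEnd.comp ((Units.coeHom _).comp f)))
    (by simpa using hk) i j h
  rw [dif_neg h] at this
  exact Units.ext (hinj (this.trans (map_one toEnd).symm))
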